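/- **Setting.** Let $D\subset\mathbb R^2$ be a bounded domain and let $E\subset D$ be a subdomain (open and connected) whose boundary has measure zero and with $\bar E\subset D$, i.e. $\operatorname{dist}(\bar E,\partial D)>0$. Let $\bar g_{\mathfrak{sh}}\in C^2(\bar D)$ be an admissible shape function, i.e. $$\bar g_{\mathfrak{sh}}\le 0\ \text{in }E,\qquad |\nabla \bar g_{\mathfrak{sh}}|+|\bar g_{\mathfrak{sh}}|>0\ \text{in }D,\qquad \bar g_{\mathfrak{sh}}>0\ \text{on }\partial D,\qquad \bar g_{\mathfrak{sh}}(x)>0\ \text{for } x\in\bar D\setminus\overline{\Omega_{\bar g_{\mathfrak{sh}}}},$$ where $\Omega_{g}:=\operatorname{int}\{x\in D: g(x)\le 0\}$. Suppose moreover that $\bar g_{\mathfrak{sh}}<0$ in $\bar E$. Let $\{\bar g_\varepsilon\}_{\varepsilon>0}\subset C^2(\bar D\setminus E)$ satisfy $\bar g_\varepsilon\to\bar g_{\mathfrak{sh}}$ in $C^2(\bar D\setminus E)$ as $\varepsilon\searrow0$ (here membership and convergence in $C^2(\bar D\setminus E)$ mean: $\bar g_\varepsilon$ is continuous on $\bar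 D\setminus E$ and $C^2$ in $D\setminus\bar E$, its first and second derivatives extend continuously to $\bar D\setminus E$, $\bar g_\varepsilon\to\bar g_{\mathfrak{sh}}$ uniformly on $\bar D\setminus E$, and the first and second derivatives converge uniformly on $D\setminus\bar E$). Let $\{h_\varepsilon\}_{\varepsilon>0}\subset C(\bar D\setminus E;\mathbb R)$ converge to $h$ uniformly on $\bar D\setminus E$ as $\varepsilon\searrow 0$. Let $d\xi$ denote integration with respect to arc length (one-dimensional Hausdorff measure). **Claim.** 1. $\nabla\bar g_{\mathfrak{sh}}\neq0$ on $\partial\Omega_{\bar g_{\mathfrak{sh}}}$, $h/|\nabla\bar g_{\mathfrak{sh}}|$ is integrable on $\partial\Omega_{\bar g_{\mathfrak{sh}}}$, and for every $z\in[0,1]$ $$\int_{\{x\in D\setminus\bar E:\ \bar g_\varepsilon(x)=\varepsilon z\}}\frac{h_\varepsilon}{|\nabla\bar g_\varepsilon|}\,d\xi\ \longrightarrow\ \int_{\partial\Omega_{\bar g_{\mathfrak{sh}}}}\frac{h}{|\nabla\bar g_{\mathfrak{sh}}|}\,d\xi\qquad\text{as }\varepsilon\searrow0 .$$ 2. There are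 $\varepsilon_0>0$ and $c>0$ such that for all $\varepsilon\in(0,\varepsilon_0]$ and all $z\in[0,1]$: $\nabla\bar g_\varepsilon\ne0$ on $\{x\in D\setminus\bar E:\bar g_\varepsilon(x)=\varepsilon z\}$, $h_\varepsilon/|\nabla\bar g_\varepsilon|$ is integrable on this set, and $$\Big|\int_{\{x\in D\setminus\bar E:\ \bar g_\varepsilon(x)=\varepsilon z\}}\frac{h_\varepsilon}{|\nabla\bar g_\varepsilon|}\,d\xi\Big|\le c .$$ -/

import Mathlib

open Set Filter Topology MeasureTheory
open scoped Gradient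

/-- The Euclidean plane. -/
abbrev Plane : Type := EuclideanSpace ℝ (Fin 2)

/-- `g` is of class `C²` on the open set `U`, and `g`, its first and its second derivative extend
continuously to `K` (`U ⊆ K ⊆ closure U` in the typical case, and then this is `g ∈ C²(K)`). -/
structure IsC2UpTo (U K : Set Plane) (g : Plane → ℝ) : Prop where
  contDiffOn : ContDiffOn ℝ 2 g U
  continuousOn : ContinuousOn g K
  fderiv_extends : ∃ F : Plane → (Plane →L[ℝ] ℝ), ContinuousOn F K ∧ EqOn F (fderiv ℝ g) U
  fderiv_fderiv_extends : ∃ F : Plane → (Plane →L[ℝ] Plane →L[ℝ] ℝ),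
    ContinuousOn F K ∧ EqOn F (fderiv ℝ (fderiv ℝ g)) U

/-- Convergence in `C²(K)` of a family `g ε` to `g₀` as `ε ↘ 0`: the functions converge uniformly
on `K`, and the first and second derivatives converge uniformly on the open set `U` (hence so do
their continuous extensions on `closure U`). -/
structure TendstoC2 (U K : Set Plane) (g : ℝ → Plane → ℝ) (g₀ : Plane → ℝ) : Prop where
  zero : TendstoUniformlyOn g g₀ (𝓝[>] 0) K
  one : TendstoUniformlyOn (fun ε => fderiv ℝ (g ε)) (fderiv ℝ g₀) (𝓝[>] 0) U
  two : TendstoUniformlyOn (fun ε => fderiv ℝ (fderiv ℝ (g ε))) (fderiv ℝ (fderiv ℝ g₀))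
    (𝓝[>] 0) U

/-- The open set `Ω_g`, the interior of `{x ∈ D : g x ≤ 0}`. -/
def shapeDomain (D : Set Plane) (g : Plane → ℝ) : Set Plane :=
  interior {x | x ∈ D ∧ g x ≤ 0}

/-- The set of admissible shape functions on the holdall domain `D` with observation set `E`. -/
structure IsShapeFunction (D E : Set Plane) (g : Plane → ℝ) : Prop where
  isC2 : IsC2UpTo D (closure D) g
  nonpos : ∀ x ∈ E, g x ≤ 0
  regular : ∀ x ∈ D, 0 < ‖∇ g x‖ + |g x|
  pos_frontier : ∀ x ∈ frontier D, 0 < g x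
  pos_off : ∀ x ∈ closure D, x ∉ closure (shapeDomain D g) → 0 < g x

/-- The level set `{x ∈ D ∖ closure E : g x = t}`. -/
def levelCurve (D E : Set Plane) (g : Plane → ℝ) (t : ℝ) : Set Plane :=
  {x | x ∈ D \ closure E ∧ g x = t}

/-! The area formula is avoided by comparing arc length with Lebesgue measure on a line. Near a
regular zero of `g`, let `ν` be the normalized gradient and `m` its norm. By `C¹` convergence, in
one small ball `g` and all late `G i` are affine with slope `m` along `ν`, up to a relative error
`η`. In a box with axes `τ, ν` each zero set is then a graph over the same interval. Projection to
the `τ` axis is 1-Lipschitz and its inverse is `(1 + 2 * η)`-Lipschitz, so projected arc length lies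
between Lebesgue measure and `1 + 2 * η` times it (`le_projMeasure`, `projMeasure_le`).

Hence a curve integral equals an integral over the interval up to a factor close to one
(`integral_approx`). The interval integrals converge by dominated convergence, because the graph
points converge. A partition of unity glues the boxes, and the remaining error `8 * η * ∫ |f| + δ`
vanishes because `η` and `δ` are arbitrary (`tendsto_integral_zeroSet`).

For the theorem, regularity identifies the frontier of the shape domain with the compact zero set of
`gsh` in `D`, and uniform convergence forces the level curves close to it. Taking limits along `(ε,
z)` with `z` ranging over a principal filter makes convergence uniform in `z`, which yields both
claims at once. -/

/-- `τ, ν` is an orthonormal frame of the plane. -/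
structure IsFrame (τ ν : Plane) : Prop where
  norm_fst : ‖τ‖ = 1
  norm_snd : ‖ν‖ = 1
  orth : inner ℝ τ ν = 0
  decomp : ∀ v, inner ℝ τ v • τ + inner ℝ ν v • ν = v

theorem exists_isFrame {ν : Plane} (hν : ‖ν‖ = 1) : ∃ τ, IsFrame τ ν := by
  have h1 : ν 0 * ν 0 + ν 1 * ν 1 = 1 := by
    have := EuclideanSpace.norm_sq_eq ν
    rw [hν] at this
    simp [Fin.sum_univ_two] at this
    nlinarith
  have hi : ∀ x y : Plane, inner ℝ x y = x 0 * y 0 + x 1 * y 1 := by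
    intro x y
    simp [PiLp.inner_apply, Fin.sum_univ_two, mul_comm]
  refine ⟨!₂[-ν 1, ν 0], ?_, hν, ?_, ?_⟩
  · rw [EuclideanSpace.norm_eq, Real.sqrt_eq_one]
    simp [Fin.sum_univ_two]
    nlinarith
  · rw [hi]
    simp
    ring
  · intro v
    rw [hi, hi]
    ext i
    fin_cases i
    · simp
      linear_combination (v 0) * h1
    · simp
      linear_combination (v 1) * h1

theorem IsFrame.norm_le {τ ν : Plane} (hf : IsFrame τ ν) (v : Plane) :
    ‖v‖ ≤ |inner ℝ τ v| + |inner ℝ ν v| := by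
  conv_lhs => rw [← hf.decomp v]
  refine (norm_add_le _ _).trans ?_
  rw [norm_smul, norm_smul, hf.norm_fst, hf.norm_snd]
  simp

theorem IsFrame.abs_inner_fst_le {τ ν : Plane} (hf : IsFrame τ ν) (v : Plane) :
    |inner ℝ τ v| ≤ ‖v‖ := by
  simpa [hf.norm_fst] using abs_real_inner_le_norm τ v

/-! ### Nearly linear functions and their zeros in a box -/

/-- `G` is, up to a relative error `η`, affine with slope `m` in the direction `ν`. -/
def NearlyLinearOn (G : Plane → ℝ) (ν : Plane) (m η : ℝ) (s : Set Plane) : Prop :=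
  ∀ x ∈ s, ∀ y ∈ s, |G x - G y - m * inner ℝ ν (x - y)| ≤ η * m * ‖x - y‖

/-- On a level set the normal component of `x - y` is at most `η * ‖x - y‖`, so the tangential one
is at least `(1 - η) * ‖x - y‖`; and `(1 + 2 * η) * (1 - η) ≥ 1`. This gives both uniqueness and the
Lipschitz bound of the graph. -/
theorem NearlyLinearOn.norm_sub_le {G : Plane → ℝ} {τ ν : Plane} {m η : ℝ} {s : Set Plane}
    (hG : NearlyLinearOn G ν m η s) (hf : IsFrame τ ν) (hm : 0 < m) (hη : 0 < η) (hη' : η ≤ 1 / 4)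
    {x y : Plane} (hx : x ∈ s) (hy : y ∈ s) (hxy : G x = G y) :
    ‖x - y‖ ≤ (1 + 2 * η) * |inner ℝ τ (x - y)| := by
  have h1 := hG x hx y hy
  rw [hxy, sub_self, zero_sub, abs_neg, abs_mul, abs_of_pos hm, mul_comm η m, mul_assoc] at h1
  have h2 := le_of_mul_le_mul_left h1 hm
  have h3 := hf.norm_le (x - y)
  have h4 : (1 - η) * ‖x - y‖ ≤ |inner ℝ τ (x - y)| := by linarith
  have h5 := mul_le_mul_of_nonneg_left h4 (by linarith : 0 ≤ 1 + 2 * η)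
  have h6 : 0 ≤ ‖x - y‖ * (η * (1 - 2 * η)) :=
    mul_nonneg (norm_nonneg _) (mul_nonneg hη.le (by linarith))
  linarith

theorem NearlyLinearOn.continuousOn {G : Plane → ℝ} {ν : Plane} {m η : ℝ} {s : Set Plane}
    (hG : NearlyLinearOn G ν m η s) (hν : ‖ν‖ = 1) (hm : 0 < m) (hη : 0 < η) :
    ContinuousOn G s := by
  refine (LipschitzOnWith.of_dist_le_mul (K := ⟨(1 + η) * m, by positivity⟩) ?_).continuousOn
  intro x hx y hy
  rw [Real.dist_eq, dist_eq_norm]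
  have h1 := abs_le.1 (hG x hx y hy)
  have h2 : |inner ℝ ν (x - y)| ≤ ‖x - y‖ := by
    simpa [hν] using abs_real_inner_le_norm ν (x - y)
  have h3 := abs_le.1 h2
  change _ ≤ (1 + η) * m * _
  rw [abs_le]
  constructor <;> nlinarith

/-- The square of half side `r` centred at `p` with axes `τ, ν`. -/
def frameBox (p τ ν : Plane) (r : ℝ) : Set Plane :=
  {x | |inner ℝ τ (x - p)| < r ∧ |inner ℝ ν (x - p)| < r}

theorem isOpen_frameBox (p τ ν : Plane) (r : ℝ) : IsOpen (frameBox p τ ν r) :=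
  (isOpen_lt (f := fun x => |inner ℝ τ (x - p)|) (by fun_prop) continuous_const).inter
    (isOpen_lt (f := fun x => |inner ℝ ν (x - p)|) (by fun_prop) continuous_const)

theorem mem_frameBox_self {p τ ν : Plane} {r : ℝ} (hr : 0 < r) : p ∈ frameBox p τ ν r := by
  simp [frameBox, hr]

theorem IsFrame.mem_ball {τ ν : Plane} (hf : IsFrame τ ν) {p : Plane} {r s t : ℝ}
    (hs : |s| < r) (ht : |t| ≤ r) : p + (s • τ + t • ν) ∈ Metric.ball p (2 * r) := by
  rw [mem_ball_iff_norm, add_sub_cancel_left]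
  refine (norm_add_le _ _).trans_lt ?_
  rw [norm_smul, norm_smul, hf.norm_fst, hf.norm_snd]
  simp only [Real.norm_eq_abs]
  linarith

theorem IsFrame.frameBox_subset {τ ν : Plane} (hf : IsFrame τ ν) (p : Plane) (r : ℝ) :
    frameBox p τ ν r ⊆ Metric.ball p (2 * r) := by
  intro x hx
  rw [mem_ball_iff_norm]
  have := hf.norm_le (x - p)
  linarith [hx.1, hx.2]

theorem IsFrame.inner_fst {τ ν : Plane} (hf : IsFrame τ ν) (s t : ℝ) :
    inner ℝ τ (s • τ + t • ν) = s := by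
  rw [inner_add_right, inner_smul_right, inner_smul_right, hf.orth, real_inner_self_eq_norm_sq,
    hf.norm_fst]
  simp

theorem IsFrame.inner_snd {τ ν : Plane} (hf : IsFrame τ ν) (s t : ℝ) :
    inner ℝ ν (s • τ + t • ν) = t := by
  rw [inner_add_right, inner_smul_right, inner_smul_right, real_inner_comm, hf.orth,
    real_inner_self_eq_norm_sq, hf.norm_snd]
  simp

/-- Intermediate value theorem on the segment over `a` in direction `ν`: at its ends `G` differs
from `± m * r` by less than `m * r / 4 + m * r / 2`, so the signs are opposite. -/
theorem NearlyLinearOn.exists_zero {G : Plane → ℝ} {p τ ν : Plane} {m η r : ℝ}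
    (hG : NearlyLinearOn G ν m η (Metric.ball p (2 * r))) (hf : IsFrame τ ν) (hm : 0 < m)
    (hη : 0 < η) (hη' : η ≤ 1 / 4) (hr : 0 < r) (hp : |G p| < m * r / 4) {a : ℝ} (ha : |a| < r) :
    ∃ x, x ∈ frameBox p τ ν r ∧ inner ℝ τ (x - p) = a ∧ G x = 0 := by
  set c : ℝ → Plane := fun t => p + (a • τ + t • ν) with hc
  have hcb : ∀ t ∈ Icc (-r) r, c t ∈ Metric.ball p (2 * r) := fun t ht =>
    hf.mem_ball ha (abs_le.2 ht)
  have hpb : p ∈ Metric.ball p (2 * r) := Metric.mem_ball_self (by linarith)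
  have hcont : ContinuousOn (fun t => G (c t)) (Icc (-r) r) :=
    (hG.continuousOn hf.norm_snd hm hη).comp (by fun_prop) hcb
  have key : ∀ t ∈ Icc (-r) r, |G (c t) - G p - m * t| ≤ η * m * (2 * r) := by
    intro t ht
    have h1 := hG _ (hcb t ht) p hpb
    rw [hc] at h1
    simp only [add_sub_cancel_left, hf.inner_snd] at h1
    refine h1.trans ?_
    have h2 := (mem_ball_iff_norm.1 (hcb t ht)).le
    simp only [hc, add_sub_cancel_left] at h2
    gcongr
  have hp' := abs_lt.1 hp
  have hmr : 0 < m * r := by positivity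
  have h1 := abs_le.1 (key r (by constructor <;> linarith))
  have h2 := abs_le.1 (key (-r) (by constructor <;> linarith))
  have hpos : 0 < G (c r) := by nlinarith
  have hneg : G (c (-r)) < 0 := by nlinarith
  obtain ⟨t, ht, ht0⟩ := intermediate_value_Icc (by linarith : -r ≤ r) hcont ⟨hneg.le, hpos.le⟩
  have ht0' : G (c t) = 0 := ht0
  refine ⟨c t, ⟨?_, ?_⟩, ?_, ht0'⟩
  · simpa [hc, add_sub_cancel_left, hf.inner_fst] using ha
  · simp only [hc, add_sub_cancel_left, hf.inner_snd]
    rw [abs_lt]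
    constructor
    · rcases ht.1.lt_or_eq with h | h
      · exact h
      · rw [← h] at ht0'; linarith
    · rcases ht.2.lt_or_eq with h | h
      · exact h
      · rw [h] at ht0'; linarith
  · simp only [hc, add_sub_cancel_left, hf.inner_fst]

/-! ### The zero set as a Lipschitz graph -/

/-- The zero of `G` in the box over the coordinate `a`. -/
noncomputable def graphPoint (G : Plane → ℝ) (p τ ν : Plane) (r a : ℝ) : Plane :=
  Classical.epsilon fun x => x ∈ frameBox p τ ν r ∧ inner ℝ τ (x - p) = a ∧ G x = 0

/-- The data under which the zero set of `G` in the box is a nearly flat graph. -/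
structure IsNearlyFlat (G : Plane → ℝ) (p τ ν : Plane) (m η r : ℝ) : Prop where
  frame : IsFrame τ ν
  m_pos : 0 < m
  eta_pos : 0 < η
  eta_le : η ≤ 1 / 4
  r_pos : 0 < r
  nearlyLinear : NearlyLinearOn G ν m η (Metric.ball p (2 * r))
  small : |G p| < m * r / 4

namespace IsNearlyFlat

variable {G : Plane → ℝ} {p τ ν : Plane} {m η r : ℝ}

theorem graphPoint_spec (hG : IsNearlyFlat G p τ ν m η r) {a : ℝ} (ha : a ∈ Ioo (-r) r) :
    graphPoint G p τ ν r a ∈ frameBox p τ ν r ∧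
      inner ℝ τ (graphPoint G p τ ν r a - p) = a ∧ G (graphPoint G p τ ν r a) = 0 :=
  Classical.epsilon_spec (hG.nearlyLinear.exists_zero hG.frame hG.m_pos hG.eta_pos hG.eta_le
    hG.r_pos hG.small (abs_lt.2 ha))

theorem eq_graphPoint (hG : IsNearlyFlat G p τ ν m η r) {x : Plane}
    (hx : x ∈ frameBox p τ ν r) (hx0 : G x = 0) :
    graphPoint G p τ ν r (inner ℝ τ (x - p)) = x := by
  obtain ⟨h1, h2, h3⟩ := hG.graphPoint_spec (a := inner ℝ τ (x - p)) (abs_lt.1 hx.1)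
  have hsub := hG.frame.frameBox_subset p r
  have := hG.nearlyLinear.norm_sub_le hG.frame hG.m_pos hG.eta_pos hG.eta_le (hsub h1) (hsub hx)
    (h3.trans hx0.symm)
  have h4 : inner ℝ τ (graphPoint G p τ ν r (inner ℝ τ (x - p)) - x) = 0 := by
    rw [← sub_sub_sub_cancel_right _ x p, inner_sub_right τ (_ - p), h2, sub_self]
  rw [h4, abs_zero, mul_zero] at this
  exact sub_eq_zero.1 (norm_le_zero_iff.1 this)

theorem lipschitzOnWith (hG : IsNearlyFlat G p τ ν m η r) :
    LipschitzOnWith (1 + 2 * η).toNNReal (graphPoint G p τ ν r) (Ioo (-r) r) := by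
  refine LipschitzOnWith.of_dist_le_mul fun a ha b hb => ?_
  obtain ⟨h1, h2, h3⟩ := hG.graphPoint_spec ha
  obtain ⟨k1, k2, k3⟩ := hG.graphPoint_spec hb
  have hsub := hG.frame.frameBox_subset p r
  have := hG.nearlyLinear.norm_sub_le hG.frame hG.m_pos hG.eta_pos hG.eta_le (hsub h1) (hsub k1)
    (h3.trans k3.symm)
  have he := hG.eta_pos
  rw [dist_eq_norm, Real.dist_eq, Real.coe_toNNReal _ (by linarith)]
  rwa [← sub_sub_sub_cancel_right _ (graphPoint G p τ ν r b) p, inner_sub_right, h2, k2,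
    sub_sub_sub_cancel_right] at this

theorem measurableSet_zero (hG : IsNearlyFlat G p τ ν m η r) :
    MeasurableSet {x | x ∈ frameBox p τ ν r ∧ G x = 0} := by
  have hc : ContinuousOn G (frameBox p τ ν r) :=
    (hG.nearlyLinear.continuousOn hG.frame.norm_snd hG.m_pos hG.eta_pos).mono
      (hG.frame.frameBox_subset p r)
  have ho := hc.isOpen_inter_preimage (isOpen_frameBox p τ ν r)
    (isOpen_compl_singleton (x := (0 : ℝ)))
  convert (isOpen_frameBox p τ ν r).measurableSet.diff ho.measurableSet using 1
  ext x
  simp only [mem_ofPred_eq, Set.mem_sdiff, mem_inter_iff, mem_preimage, mem_compl_iff,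
    mem_singleton_iff]
  tauto

/-! ### Arc length compared with Lebesgue measure -/

/-- The projection to the first axis of the arc length on the zero set. -/
noncomputable def projMeasure (G : Plane → ℝ) (p τ ν : Plane) (r : ℝ) : Measure ℝ :=
  (Measure.map (fun x => inner ℝ τ (x - p))
    ((μH[1] : Measure Plane).restrict {x | x ∈ frameBox p τ ν r ∧ G x = 0}))

theorem measurable_proj (p τ : Plane) : Measurable (fun x : Plane => inner ℝ τ (x - p)) :=
  Continuous.measurable (by fun_prop)

/-- The projection is 1-Lipschitz and, by existence of zeros, covers the whole interval;
one-dimensional Hausdorff measure on `ℝ` is Lebesgue measure. -/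
theorem le_projMeasure (hG : IsNearlyFlat G p τ ν m η r) :
    volume.restrict (Ioo (-r) r) ≤ projMeasure G p τ ν r := by
  refine Measure.le_iff.2 fun A hA => ?_
  have hm := measurable_proj p τ
  rw [projMeasure, Measure.map_apply hm hA, Measure.restrict_apply hA,
    Measure.restrict_apply (hm hA)]
  have hl : LipschitzWith 1 (fun x : Plane => inner ℝ τ (x - p)) := by
    refine LipschitzWith.of_dist_le_mul fun x y => ?_
    rw [Real.dist_eq, ← inner_sub_right, sub_sub_sub_cancel_right, dist_eq_norm]
    simpa using hG.frame.abs_inner_fst_le (x - y)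
  have h1 := hl.hausdorffMeasure_image_le (d := 1) zero_le_one
    ((fun x => inner ℝ τ (x - p)) ⁻¹' A ∩ {x | x ∈ frameBox p τ ν r ∧ G x = 0})
  rw [hausdorffMeasure_real] at h1
  simp only [ENNReal.coe_one, ENNReal.one_rpow, one_mul] at h1
  refine (measure_mono ?_).trans h1
  rintro a ⟨haA, ha⟩
  obtain ⟨k1, k2, k3⟩ := hG.graphPoint_spec ha
  exact ⟨_, ⟨by simpa [k2] using haA, k1, k3⟩, k2⟩

/-- By uniqueness of zeros, the part of the curve over `A` is contained in the image of `A` under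
the Lipschitz graph map. -/
theorem projMeasure_le (hG : IsNearlyFlat G p τ ν m η r) :
    projMeasure G p τ ν r ≤
      ENNReal.ofReal (1 + 2 * η) • volume.restrict (Ioo (-r) r) := by
  refine Measure.le_iff.2 fun A hA => ?_
  have hm := measurable_proj p τ
  rw [projMeasure, Measure.map_apply hm hA, Measure.smul_apply, Measure.restrict_apply hA,
    Measure.restrict_apply (hm hA)]
  have h1 := (hG.lipschitzOnWith.mono inter_subset_right :
    LipschitzOnWith _ _ (A ∩ Ioo (-r) r)).hausdorffMeasure_image_le (d := 1) zero_le_one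
  rw [hausdorffMeasure_real, ENNReal.rpow_one] at h1
  refine (measure_mono ?_).trans h1
  rintro x ⟨hxA, hx, hx0⟩
  exact ⟨_, ⟨hxA, abs_lt.1 hx.1⟩, hG.eq_graphPoint hx hx0⟩

end IsNearlyFlat

/-- The difference of the integrals is the integral against `μ - ν`, a positive measure bounded by
`c` times `ν`. -/
theorem integral_sub_integral_le_of_measure_le {α : Type*} [MeasurableSpace α] {μ ν : Measure α}
    [IsFiniteMeasure μ] [IsFiniteMeasure ν] {c : ℝ} (hc : 0 ≤ c) (h1 : ν ≤ μ)
    (h2 : μ ≤ ENNReal.ofReal (1 + c) • ν) {f : α → ℝ} (hf : Integrable f ν) :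
    Integrable f μ ∧ |∫ x, f x ∂μ - ∫ x, f x ∂ν| ≤ c * ∫ x, |f x| ∂ν := by
  have hfμ : Integrable f μ := (hf.smul_measure ENNReal.ofReal_ne_top).mono_measure h2
  refine ⟨hfμ, ?_⟩
  have hs : μ - ν ≤ ENNReal.ofReal c • ν := by
    refine Measure.sub_le_of_le_add ?_
    rwa [ENNReal.ofReal_add zero_le_one hc, add_comm, add_smul, ENNReal.ofReal_one, one_smul] at h2
  have hfs : Integrable f (μ - ν) := hfμ.mono_measure Measure.sub_le
  have he : ∫ x, f x ∂μ = ∫ x, f x ∂(μ - ν) + ∫ x, f x ∂ν := by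
    conv_lhs => rw [← Measure.sub_add_cancel_of_le h1]
    exact integral_add_measure hfs hf
  rw [he, add_sub_cancel_right]
  calc |∫ x, f x ∂(μ - ν)| ≤ ∫ x, |f x| ∂(μ - ν) := abs_integral_le_integral_abs
    _ ≤ ∫ x, |f x| ∂(ENNReal.ofReal c • ν) :=
        integral_mono_measure hs (Eventually.of_forall fun x => abs_nonneg _)
          (hf.abs.smul_measure ENNReal.ofReal_ne_top)
    _ = c * ∫ x, |f x| ∂ν := by
        rw [integral_smul_measure, ENNReal.toReal_ofReal hc, smul_eq_mul]

namespace IsNearlyFlat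

variable {G : Plane → ℝ} {p τ ν : Plane} {m η r : ℝ}

/-- On the curve `f` is a function of the tangential coordinate alone, so its integral is one
against `projMeasure`, which is squeezed by Lebesgue measure. -/
theorem integral_approx (hG : IsNearlyFlat G p τ ν m η r) {f : Plane → ℝ} {M : ℝ}
    (hf : ContinuousOn f (frameBox p τ ν r)) (hM : ∀ x ∈ frameBox p τ ν r, |f x| ≤ M) :
    IntegrableOn (fun a => f (graphPoint G p τ ν r a)) (Ioo (-r) r) ∧
    IntegrableOn f {x | x ∈ frameBox p τ ν r ∧ G x = 0} μH[1] ∧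
    |∫ x in {x | x ∈ frameBox p τ ν r ∧ G x = 0}, f x ∂μH[1] -
      ∫ a in Ioo (-r) r, f (graphPoint G p τ ν r a)| ≤
      2 * η * ∫ a in Ioo (-r) r, |f (graphPoint G p τ ν r a)| := by
  have hcont : ContinuousOn (fun a => f (graphPoint G p τ ν r a)) (Ioo (-r) r) :=
    hf.comp hG.lipschitzOnWith.continuousOn fun a ha => (hG.graphPoint_spec ha).1
  have hint : IntegrableOn (fun a => f (graphPoint G p τ ν r a)) (Ioo (-r) r) := by
    refine Integrable.of_bound (hcont.aestronglyMeasurable measurableSet_Ioo) M ?_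
    refine (ae_restrict_iff' measurableSet_Ioo).2 (Eventually.of_forall fun a ha => ?_)
    exact hM _ (hG.graphPoint_spec ha).1
  have hfin : IsFiniteMeasure (projMeasure G p τ ν r) := by
    refine ⟨(hG.projMeasure_le univ).trans_lt ?_⟩
    rw [Measure.smul_apply]
    exact ENNReal.mul_lt_top ENNReal.ofReal_lt_top (measure_lt_top _ _)
  have hη := hG.eta_pos
  obtain ⟨hi, hb⟩ := integral_sub_integral_le_of_measure_le (by positivity) hG.le_projMeasure
    hG.projMeasure_le hint
  have hm := measurable_proj p τ
  have hae : ∀ᵐ x ∂((μH[1] : Measure Plane).restrict {x | x ∈ frameBox p τ ν r ∧ G x = 0}),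
      f (graphPoint G p τ ν r (inner ℝ τ (x - p))) = f x := by
    refine (ae_restrict_iff' hG.measurableSet_zero).2 (Eventually.of_forall fun x hx => ?_)
    rw [hG.eq_graphPoint hx.1 hx.2]
  have hi' := hi.comp_measurable hm
  refine ⟨hint, hi'.congr hae, ?_⟩
  rw [projMeasure, integral_map hm.aemeasurable hi.aestronglyMeasurable,
    integral_congr_ae hae] at hb
  exact hb

end IsNearlyFlat

/-! ### Flatness from `C¹` closeness -/

theorem nearlyLinearOn_of_fderiv {G : Plane → ℝ} {ν p : Plane} {m η R : ℝ}
    (hd : ∀ x ∈ Metric.ball p R, DifferentiableAt ℝ G x)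
    (hb : ∀ x ∈ Metric.ball p R, ‖fderiv ℝ G x - m • innerSL ℝ ν‖ ≤ η * m) :
    NearlyLinearOn G ν m η (Metric.ball p R) := by
  intro x hx y hy
  have := (convex_ball p R).norm_image_sub_le_of_norm_fderiv_le' hd hb hy hx
  simpa [Real.norm_eq_abs] using this

/-- Eventual differentiability and uniform convergence of values and derivatives on `V`. -/
structure TendstoC1On {ι : Type*} (l : Filter ι) (G : ι → Plane → ℝ) (g : Plane → ℝ)
    (V : Set Plane) : Prop where
  diff : ∀ᶠ i in l, DifferentiableOn ℝ (G i) V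
  zero : TendstoUniformlyOn G g l V
  one : TendstoUniformlyOn (fun i => fderiv ℝ (G i)) (fderiv ℝ g) l V

/-- The point is that one frame, slope and radius serve `g` and all late `G i`, so that the graphs
live over a common interval. -/
theorem exists_isNearlyFlat {ι : Type*} {l : Filter ι} {G : ι → Plane → ℝ} {g : Plane → ℝ}
    {V : Set Plane} (hV : IsOpen V) (hg : ContDiffOn ℝ 1 g V) (hG : TendstoC1On l G g V)
    {p : Plane} (hp : p ∈ V) (hp0 : g p = 0) (hp1 : fderiv ℝ g p ≠ 0) {η : ℝ} (hη : 0 < η)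
    (hη' : η ≤ 1 / 4) :
    ∃ τ ν m r, Metric.ball p (2 * r) ⊆ V ∧ IsNearlyFlat g p τ ν m η r ∧
      ∀ᶠ i in l, IsNearlyFlat (G i) p τ ν m η r := by
  set w : Plane := ∇ g p with hw
  have hL : fderiv ℝ g p = innerSL ℝ w := by
    ext v
    rw [innerSL_apply_apply, hw, inner_gradient_left]
  have hw0 : w ≠ 0 := by
    rintro h
    rw [h, map_zero] at hL
    exact hp1 hL
  have hm : 0 < ‖w‖ := norm_pos_iff.2 hw0
  set ν : Plane := ‖w‖⁻¹ • w with hν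
  have hν1 : ‖ν‖ = 1 := by
    rw [hν, norm_smul, norm_inv, norm_norm, inv_mul_cancel₀ hm.ne']
  obtain ⟨τ, hf⟩ := exists_isFrame hν1
  have hLν : fderiv ℝ g p = ‖w‖ • innerSL ℝ ν := by
    rw [hL, hν, map_smul, smul_smul, mul_inv_cancel₀ hm.ne', one_smul]
  have hcont : ContinuousAt (fderiv ℝ g) p :=
    (hg.continuousOn_fderiv_of_isOpen hV le_rfl).continuousAt (hV.mem_nhds hp)
  -- Half of the error budget `η * m` goes to the variation of the derivative of `g`, half to the
  -- distance between the derivatives of `G i` and `g`.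
  have hηm : 0 < η * ‖w‖ / 2 := by positivity
  obtain ⟨R, hR, hRsub⟩ := Metric.mem_nhds_iff.1
    (inter_mem (hV.mem_nhds hp) (Metric.continuousAt_iff'.1 hcont _ hηm))
  have hRV : Metric.ball p R ⊆ V := fun x hx => (hRsub hx).1
  have h2 : 2 * (R / 2) = R := by ring
  have hbd : ∀ x ∈ Metric.ball p R, ‖fderiv ℝ g x - ‖w‖ • innerSL ℝ ν‖ < η * ‖w‖ / 2 := by
    intro x hx
    have := (hRsub hx).2
    rwa [mem_ofPred_eq, dist_eq_norm, hLν] at this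
  have hr : 0 < R / 2 := by positivity
  refine ⟨τ, ν, ‖w‖, R / 2, by rwa [h2], ⟨hf, hm, hη, hη', hr, ?_, ?_⟩, ?_⟩
  · rw [h2]
    refine nearlyLinearOn_of_fderiv (fun x hx => ?_) fun x hx => ?_
    · exact (hg.differentiableOn one_ne_zero).differentiableAt (hV.mem_nhds (hRV hx))
    · linarith [hbd x hx]
  · rw [hp0, abs_zero]; positivity
  · have hs : 0 < ‖w‖ * (R / 2) / 4 := by positivity
    filter_upwards [hG.diff, Metric.tendstoUniformlyOn_iff.1 hG.zero _ hs,
      Metric.tendstoUniformlyOn_iff.1 hG.one _ hηm] with i hi hi0 hi1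
    refine ⟨hf, hm, hη, hη', hr, ?_, ?_⟩
    · rw [h2]
      refine nearlyLinearOn_of_fderiv (fun x hx => ?_) fun x hx => ?_
      · exact hi.differentiableAt (hV.mem_nhds (hRV hx))
      · have k1 := hi1 x (hRV hx)
        rw [dist_comm, dist_eq_norm] at k1
        have k2 := norm_add_le (fderiv ℝ (G i) x - fderiv ℝ g x)
          (fderiv ℝ g x - ‖w‖ • innerSL ℝ ν)
        rw [sub_add_sub_cancel] at k2
        linarith [hbd x hx]
    · have := hi0 p hp
      rwa [hp0, dist_comm, Real.dist_eq, sub_zero] at this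

/-! ### Convergence inside one box -/

namespace IsNearlyFlat

variable {ι : Type*} {l : Filter ι} {G : ι → Plane → ℝ} {g : Plane → ℝ} {p τ ν : Plane}
  {m η r : ℝ}

/-- The two points share their tangential coordinate, so they differ along `ν` only, where `g'`
grows with slope at least `(1 - η) * m`. -/
theorem norm_graphPoint_sub_le {g' : Plane → ℝ} (hg : IsNearlyFlat g p τ ν m η r)
    (hG : IsNearlyFlat g' p τ ν m η r) {a : ℝ} (ha : a ∈ Ioo (-r) r) :
    ‖graphPoint g' p τ ν r a - graphPoint g p τ ν r a‖ ≤
      2 / m * |g' (graphPoint g p τ ν r a)| := by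
  obtain ⟨x1, x2, -⟩ := hg.graphPoint_spec ha
  obtain ⟨y1, y2, y3⟩ := hG.graphPoint_spec ha
  set x := graphPoint g p τ ν r a
  set y := graphPoint g' p τ ν r a
  have hsub := hg.frame.frameBox_subset p r
  have hm := hg.m_pos
  have h1 := hG.nearlyLinear y (hsub y1) x (hsub x1)
  have h2 := hg.frame.norm_le (y - x)
  have h3 : inner ℝ τ (y - x) = 0 := by
    rw [← sub_sub_sub_cancel_right y x p, inner_sub_right τ (y - p), x2, y2, sub_self]
  rw [h3, abs_zero, zero_add] at h2
  have h4 : m * |inner ℝ ν (y - x)| ≤ |g' x| + η * m * ‖y - x‖ := by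
    rw [← abs_of_pos hm, ← abs_mul, abs_of_pos hm]
    rw [y3, zero_sub, abs_le] at h1
    have h6 := le_abs_self (g' x)
    have h7 := neg_abs_le (g' x)
    rw [abs_le]
    constructor <;> linarith
  have h5 : m * ‖y - x‖ ≤ |g' x| + 1 / 4 * (m * ‖y - x‖) := by
    have := mul_le_mul_of_nonneg_left h2 hm.le
    have := mul_le_mul_of_nonneg_right hg.eta_le (by positivity : 0 ≤ m * ‖y - x‖)
    linarith
  rw [div_mul_eq_mul_div, le_div_iff₀ hm]
  have : 0 ≤ m * ‖y - x‖ := by positivity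
  linarith

theorem tendsto_graphPoint (hg : IsNearlyFlat g p τ ν m η r)
    (hG : ∀ᶠ i in l, IsNearlyFlat (G i) p τ ν m η r)
    (hlim : ∀ x ∈ frameBox p τ ν r, Tendsto (fun i => G i x) l (𝓝 (g x)))
    {a : ℝ} (ha : a ∈ Ioo (-r) r) :
    Tendsto (fun i => graphPoint (G i) p τ ν r a) l (𝓝 (graphPoint g p τ ν r a)) := by
  obtain ⟨x1, -, x3⟩ := hg.graphPoint_spec ha
  rw [tendsto_iff_norm_sub_tendsto_zero]
  have h1 : Tendsto (fun i => 2 / m * |G i (graphPoint g p τ ν r a)|) l (𝓝 0) := by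
    have := ((hlim _ x1).abs).const_mul (2 / m)
    rwa [x3, abs_zero, mul_zero] at this
  refine squeeze_zero' (Eventually.of_forall fun i => norm_nonneg _) ?_ h1
  filter_upwards [hG] with i hi using hg.norm_graphPoint_sub_le hi ha

theorem tendsto_integral_graph [l.IsCountablyGenerated] (hg : IsNearlyFlat g p τ ν m η r)
    (hG : ∀ᶠ i in l, IsNearlyFlat (G i) p τ ν m η r)
    (hlim : ∀ x ∈ frameBox p τ ν r, Tendsto (fun i => G i x) l (𝓝 (g x)))
    {F : ι → Plane → ℝ} {f : Plane → ℝ} {M : ℝ}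
    (hF : ∀ᶠ i in l, ContinuousOn (F i) (frameBox p τ ν r))
    (hFM : ∀ᶠ i in l, ∀ x ∈ frameBox p τ ν r, |F i x| ≤ M)
    (hFf : ∀ x ∈ frameBox p τ ν r,
      Tendsto (fun q : ι × Plane => F q.1 q.2) (l ×ˢ 𝓝 x) (𝓝 (f x))) :
    Tendsto (fun i => ∫ a in Ioo (-r) r, F i (graphPoint (G i) p τ ν r a)) l
      (𝓝 (∫ a in Ioo (-r) r, f (graphPoint g p τ ν r a))) := by
  refine tendsto_integral_filter_of_dominated_convergence (fun _ => M) ?_ ?_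
    (integrable_const M) ?_
  · filter_upwards [hG, hF, hFM] with i h1 h2 h3
    exact (h1.integral_approx h2 h3).1.aestronglyMeasurable
  · filter_upwards [hG, hFM] with i h1 h3
    refine (ae_restrict_iff' measurableSet_Ioo).2 (Eventually.of_forall fun a ha => ?_)
    exact h3 _ (h1.graphPoint_spec ha).1
  · refine (ae_restrict_iff' measurableSet_Ioo).2 (Eventually.of_forall fun a ha => ?_)
    exact (hFf _ (hg.graphPoint_spec ha).1).comp
      (tendsto_id.prodMk (hg.tendsto_graphPoint hG hlim ha))

theorem eventually_integral_sub_le [l.IsCountablyGenerated] (hg : IsNearlyFlat g p τ ν m η r)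
    (hG : ∀ᶠ i in l, IsNearlyFlat (G i) p τ ν m η r)
    (hlim : ∀ x ∈ frameBox p τ ν r, Tendsto (fun i => G i x) l (𝓝 (g x)))
    {F : ι → Plane → ℝ} {f : Plane → ℝ} {M : ℝ}
    (hF : ∀ᶠ i in l, ContinuousOn (F i) (frameBox p τ ν r))
    (hFM : ∀ᶠ i in l, ∀ x ∈ frameBox p τ ν r, |F i x| ≤ M)
    (hf : ContinuousOn f (frameBox p τ ν r)) (hfM : ∀ x ∈ frameBox p τ ν r, |f x| ≤ M)
    (hFf : ∀ x ∈ frameBox p τ ν r,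
      Tendsto (fun q : ι × Plane => F q.1 q.2) (l ×ˢ 𝓝 x) (𝓝 (f x))) {δ : ℝ} (hδ : 0 < δ) :
    ∀ᶠ i in l, |∫ x in {x | x ∈ frameBox p τ ν r ∧ G i x = 0}, F i x ∂μH[1] -
      ∫ x in {x | x ∈ frameBox p τ ν r ∧ g x = 0}, f x ∂μH[1]| ≤
      8 * η * ∫ x in {x | x ∈ frameBox p τ ν r ∧ g x = 0}, |f x| ∂μH[1] + δ := by
  have hη := hg.eta_pos
  have hη' := hg.eta_le
  have t1 := hg.tendsto_integral_graph hG hlim hF hFM hFf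
  have t2 := hg.tendsto_integral_graph (F := fun i x => |F i x|) (f := fun x => |f x|) (M := M)
    hG hlim (hF.mono fun i h => h.abs) (by simpa using hFM) fun x hx => (hFf x hx).abs
  obtain ⟨-, -, h1⟩ := hg.integral_approx hf hfM
  obtain ⟨-, -, h2⟩ := hg.integral_approx (f := fun x => |f x|) (M := M) hf.abs (by simpa using hfM)
  simp only [abs_abs] at h2
  set b := ∫ a in Ioo (-r) r, f (graphPoint g p τ ν r a)
  set c := ∫ a in Ioo (-r) r, |f (graphPoint g p τ ν r a)|
  set A := ∫ x in {x | x ∈ frameBox p τ ν r ∧ g x = 0}, |f x| ∂μH[1]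
  have hc : 0 ≤ c := integral_nonneg fun _ => abs_nonneg _
  -- `|A - c| ≤ 2 * η * c ≤ c / 2`. The two passages from curve to interval cost `2 * η * c` each in
  -- the limit, hence the constant `8 * η * A`.
  have hcA : c ≤ 2 * A := by
    have := (abs_le.1 h2).1
    nlinarith
  have t3 := ((t2.const_mul (2 * η)).add (t1.sub_const b).abs).add_const (2 * η * c)
  rw [sub_self, abs_zero, add_zero] at t3
  have hlt : 2 * η * c + 2 * η * c < 8 * η * A + δ := by nlinarith
  filter_upwards [t3.eventually_lt_const hlt, hG, hF, hFM] with i i1 i2 i3 i4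
  obtain ⟨-, -, k1⟩ := i2.integral_approx i3 i4
  rw [abs_sub_comm] at h1
  refine le_trans ?_ i1.le
  refine (abs_sub_le _ (∫ a in Ioo (-r) r, F i (graphPoint (G i) p τ ν r a)) _).trans ?_
  have := abs_sub_le (∫ a in Ioo (-r) r, F i (graphPoint (G i) p τ ν r a)) b
    (∫ x in {x | x ∈ frameBox p τ ν r ∧ g x = 0}, f x ∂μH[1])
  linarith

end IsNearlyFlat

/-! ### Gluing the boxes by a partition of unity -/

section LevelSets

variable {ι : Type*} {l : Filter ι} {G : ι → Plane → ℝ} {g : Plane → ℝ} {V : Set Plane}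

theorem exists_isNearlyFlat_cover (hV : IsOpen V) (hg : ContDiffOn ℝ 1 g V)
    (hG : TendstoC1On l G g V) (hΓ : IsCompact {x | x ∈ V ∧ g x = 0})
    (hreg : ∀ x ∈ V, g x = 0 → fderiv ℝ g x ≠ 0) {η : ℝ} (hη : 0 < η) (hη' : η ≤ 1 / 4) :
    ∃ (n : ℕ) (p τ ν : Fin n → Plane) (m r : Fin n → ℝ),
      (∀ k, frameBox (p k) (τ k) (ν k) (r k) ⊆ V) ∧
      (∀ k, IsNearlyFlat g (p k) (τ k) (ν k) (m k) η (r k)) ∧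
      (∀ᶠ i in l, ∀ k, IsNearlyFlat (G i) (p k) (τ k) (ν k) (m k) η (r k)) ∧
      {x | x ∈ V ∧ g x = 0} ⊆ ⋃ k, frameBox (p k) (τ k) (ν k) (r k) := by
  have key : ∀ q : {x | x ∈ V ∧ g x = 0}, ∃ τ ν m r, Metric.ball (q : Plane) (2 * r) ⊆ V ∧
      IsNearlyFlat g q τ ν m η r ∧ ∀ᶠ i in l, IsNearlyFlat (G i) q τ ν m η r := fun q =>
    exists_isNearlyFlat hV hg hG q.2.1 q.2.2 (hreg _ q.2.1 q.2.2) hη hη'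
  choose τ ν m r h1 h2 h3 using key
  obtain ⟨t, ht⟩ := hΓ.elim_finite_subcover
    (fun q : {x | x ∈ V ∧ g x = 0} => frameBox (q : Plane) (τ q) (ν q) (r q))
    (fun q => isOpen_frameBox _ _ _ _)
    (fun x hx => mem_iUnion.2 ⟨⟨x, hx⟩, mem_frameBox_self (h2 _).r_pos⟩)
  let e := t.equivFin.symm
  refine ⟨t.card, fun k => (e k).1, fun k => τ (e k).1, fun k => ν (e k).1, fun k => m (e k).1,
    fun k => r (e k).1, fun k => ((h2 _).frame.frameBox_subset _ _).trans (h1 _), fun k => h2 _,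
    eventually_all.2 fun k => h3 _, fun x hx => ?_⟩
  obtain ⟨q, hq, hxq⟩ := mem_iUnion₂.1 (ht hx)
  refine mem_iUnion.2 ⟨t.equivFin ⟨q, hq⟩, ?_⟩
  simpa [e] using hxq

theorem integrableOn_zeroSet {n : ℕ} {p τ ν : Fin n → Plane} {m r : Fin n → ℝ} {η : ℝ}
    (hg : ∀ k, IsNearlyFlat g (p k) (τ k) (ν k) (m k) η (r k))
    (hVk : ∀ k, frameBox (p k) (τ k) (ν k) (r k) ⊆ V)
    (hcov : {x | x ∈ V ∧ g x = 0} ⊆ ⋃ k, frameBox (p k) (τ k) (ν k) (r k))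
    {f : Plane → ℝ} {M : ℝ} (hf : ContinuousOn f V) (hfM : ∀ x ∈ V, |f x| ≤ M) :
    IntegrableOn f {x | x ∈ V ∧ g x = 0} μH[1] := by
  have h1 : IntegrableOn f (⋃ k, {x | x ∈ frameBox (p k) (τ k) (ν k) (r k) ∧ g x = 0}) μH[1] :=
    integrableOn_finite_iUnion.2 fun k =>
      ((hg k).integral_approx (hf.mono (hVk k)) fun x hx => hfM x (hVk k hx)).2.1
  refine h1.mono_set fun x hx => ?_
  obtain ⟨k, hk⟩ := mem_iUnion.1 (hcov hx)
  exact mem_iUnion.2 ⟨k, hk, hx.2⟩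

theorem measurableSet_zeroSet (hV : IsOpen V) (hg : ContinuousOn g V) :
    MeasurableSet {x | x ∈ V ∧ g x = 0} := by
  have ho := hg.isOpen_inter_preimage hV (isOpen_compl_singleton (x := (0 : ℝ)))
  convert hV.measurableSet.diff ho.measurableSet using 1
  ext x
  simp only [mem_ofPred_eq, Set.mem_sdiff, mem_inter_iff, mem_preimage, mem_compl_iff,
    mem_singleton_iff]
  tauto

theorem setIntegral_zeroSet_eq_box (hV : IsOpen V) (hg : ContinuousOn g V) {B : Set Plane}
    (hB : B ⊆ V) {f : Plane → ℝ} (hf : ∀ x, x ∉ B → f x = 0) :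
    ∫ x in {x | x ∈ V ∧ g x = 0}, f x ∂μH[1] = ∫ x in {x | x ∈ B ∧ g x = 0}, f x ∂μH[1] := by
  refine setIntegral_eq_of_subset_of_forall_sdiff_eq_zero (measurableSet_zeroSet hV hg)
    (fun x hx => ⟨hB hx.1, hx.2⟩) fun x hx => hf x fun hxB => hx.2 ⟨hxB, hx.1.2⟩

/-- Uniform-in-box estimate for the convergence of the curve integrals. -/
theorem eventually_abs_integral_sub_le [l.IsCountablyGenerated] (hV : IsOpen V)
    (hg : ContDiffOn ℝ 1 g V)
    (hG : TendstoC1On l G g V) (hΓ : IsCompact {x | x ∈ V ∧ g x = 0})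
    (hreg : ∀ x ∈ V, g x = 0 → fderiv ℝ g x ≠ 0)
    (hloc : ∀ W, IsOpen W → {x | x ∈ V ∧ g x = 0} ⊆ W → ∀ᶠ i in l, {x | x ∈ V ∧ G i x = 0} ⊆ W)
    {F : ι → Plane → ℝ} {f : Plane → ℝ} {M : ℝ}
    (hF : ∀ᶠ i in l, ContinuousOn (F i) V) (hFM : ∀ᶠ i in l, ∀ x ∈ V, |F i x| ≤ M)
    (hf : ContinuousOn f V) (hfM : ∀ x ∈ V, |f x| ≤ M)
    (hFf : ∀ x ∈ V, Tendsto (fun q : ι × Plane => F q.1 q.2) (l ×ˢ 𝓝 x) (𝓝 (f x)))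
    {η : ℝ} (hη : 0 < η) (hη' : η ≤ 1 / 4) :
    IntegrableOn f {x | x ∈ V ∧ g x = 0} μH[1] ∧
    (∀ᶠ i in l, IntegrableOn (F i) {x | x ∈ V ∧ G i x = 0} μH[1]) ∧
    ∀ δ > 0, ∀ᶠ i in l, |∫ x in {x | x ∈ V ∧ G i x = 0}, F i x ∂μH[1] -
      ∫ x in {x | x ∈ V ∧ g x = 0}, f x ∂μH[1]| ≤
      8 * η * ∫ x in {x | x ∈ V ∧ g x = 0}, |f x| ∂μH[1] + δ := by
  obtain ⟨n, p, τ, ν, m, r, hBV, hflat, hflatG, hcov⟩ :=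
    exists_isNearlyFlat_cover hV hg hG hΓ hreg hη hη'
  have hBo : ∀ k, IsOpen (frameBox (p k) (τ k) (ν k) (r k)) := fun k => isOpen_frameBox _ _ _ _
  -- The partition must sum to one on a neighbourhood of the limit curve, so that it also serves the
  -- perturbed curves, which eventually lie in `K`.
  obtain ⟨K, hK, hΓK, hKB⟩ := exists_compact_between hΓ (isOpen_iUnion hBo) hcov
  obtain ⟨φ, hφs, hφ1, hφ01, -⟩ := exists_continuous_sum_one_of_isOpen_isCompact hBo hK hKB
  have hφ1' : ∀ x ∈ K, ∑ k, φ k x = 1 := fun x hx => by simpa using hφ1 hx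
  have hφ0 : ∀ k x, x ∉ frameBox (p k) (τ k) (ν k) (r k) → φ k x = 0 := fun k x hx =>
    image_eq_zero_of_notMem_tsupport fun h => hx (hφs k h)
  have hφle : ∀ k x c, |c| ≤ M → |φ k x * c| ≤ M := fun k x c hc => by
    rw [abs_mul, abs_of_nonneg (hφ01 k x).1]
    exact (mul_le_of_le_one_left (abs_nonneg _) (hφ01 k x).2).trans hc
  have hKΓ : {x | x ∈ V ∧ g x = 0} ⊆ K := hΓK.trans interior_subset
  have hlocK : ∀ᶠ i in l, {x | x ∈ V ∧ G i x = 0} ⊆ K :=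
    (hloc _ isOpen_interior hΓK).mono fun i hi => hi.trans interior_subset
  refine ⟨integrableOn_zeroSet hflat hBV hcov hf hfM, ?_, fun δ hδ => ?_⟩
  · filter_upwards [hflatG, hlocK, hF, hFM] with i h1 h2 h3 h4
    exact integrableOn_zeroSet h1 hBV (h2.trans hKB) h3 h4
  have hsum : ∀ (u : Plane → ℝ) (v : Plane → ℝ), ContinuousOn u V →
      (∀ k, IsNearlyFlat u (p k) (τ k) (ν k) (m k) η (r k)) → {x | x ∈ V ∧ u x = 0} ⊆ K →
      ContinuousOn v V → (∀ x ∈ V, |v x| ≤ M) →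
      ∫ x in {x | x ∈ V ∧ u x = 0}, v x ∂μH[1] =
      ∑ k, ∫ x in {x | x ∈ frameBox (p k) (τ k) (ν k) (r k) ∧ u x = 0}, φ k x * v x ∂μH[1] := by
    intro u v hu hflat' huK hv hvM
    have h1 : ∫ x in {x | x ∈ V ∧ u x = 0}, v x ∂μH[1] =
        ∫ x in {x | x ∈ V ∧ u x = 0}, ∑ k, φ k x * v x ∂μH[1] := by
      refine setIntegral_congr_fun (measurableSet_zeroSet hV hu) fun x hx => ?_
      rw [← Finset.sum_mul, hφ1' x (huK hx), one_mul]
    rw [h1, integral_finsetSum]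
    · refine Finset.sum_congr rfl fun k _ => ?_
      exact setIntegral_zeroSet_eq_box hV hu (hBV k) fun x hx => by rw [hφ0 k x hx, zero_mul]
    · intro k _
      exact integrableOn_zeroSet hflat' hBV (huK.trans hKB)
        ((φ k).continuous.continuousOn.mul hv) fun x hx => hφle k x _ (hvM x hx)
  have hcontG : ∀ᶠ i in l, ContinuousOn (G i) V := hG.diff.mono fun i h => h.continuousOn
  -- The share `δ / (n + 1)` makes sense also for an empty cover, `n = 0`.
  have hloc' : ∀ k, ∀ᶠ i in l,
      |∫ x in {x | x ∈ frameBox (p k) (τ k) (ν k) (r k) ∧ G i x = 0}, φ k x * F i x ∂μH[1] -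
        ∫ x in {x | x ∈ frameBox (p k) (τ k) (ν k) (r k) ∧ g x = 0}, φ k x * f x ∂μH[1]| ≤
        8 * η * ∫ x in {x | x ∈ frameBox (p k) (τ k) (ν k) (r k) ∧ g x = 0},
          φ k x * |f x| ∂μH[1] + δ / (n + 1) := by
    intro k
    have := (hflat k).eventually_integral_sub_le (F := fun i x => φ k x * F i x)
      (f := fun x => φ k x * f x) (M := M) (hflatG.mono fun i h => h k)
      (fun x hx => hG.zero.tendsto_at (hBV k hx))
      (hF.mono fun i h => (φ k).continuous.continuousOn.mul (h.mono (hBV k)))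
      (hFM.mono fun i h x hx => hφle k x _ (h x (hBV k hx)))
      ((φ k).continuous.continuousOn.mul (hf.mono (hBV k)))
      (fun x hx => hφle k x _ (hfM x (hBV k hx)))
      (fun x hx => (((φ k).continuous.tendsto x).comp tendsto_snd).mul (hFf x (hBV k hx)))
      (δ := δ / (n + 1)) (by positivity)
    simpa only [abs_mul, abs_of_nonneg (hφ01 k _).1] using this
  filter_upwards [hflatG, hlocK, hF, hFM, hcontG, eventually_all.2 hloc'] with i h1 h2 h3 h4 h5 h6
  rw [hsum (G i) (F i) h5 h1 h2 h3 h4, hsum g f hg.continuousOn hflat hKΓ hf hfM,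
    hsum g (fun x => |f x|) hg.continuousOn hflat hKΓ hf.abs (by simpa using hfM),
    ← Finset.sum_sub_distrib]
  refine (Finset.abs_sum_le_sum_abs _ _).trans ((Finset.sum_le_sum fun k _ => h6 k).trans ?_)
  rw [Finset.sum_add_distrib, ← Finset.mul_sum]
  gcongr
  rw [Finset.sum_const, Finset.card_univ, Fintype.card_fin, nsmul_eq_mul, mul_div_assoc',
    div_le_iff₀ (by positivity)]
  nlinarith

/-- Curve integrals over the zero sets converge under `C¹` convergence near a regular compact zero
set. -/
theorem tendsto_integral_zeroSet [l.IsCountablyGenerated] (hV : IsOpen V)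
    (hg : ContDiffOn ℝ 1 g V)
    (hG : TendstoC1On l G g V) (hΓ : IsCompact {x | x ∈ V ∧ g x = 0})
    (hreg : ∀ x ∈ V, g x = 0 → fderiv ℝ g x ≠ 0)
    (hloc : ∀ W, IsOpen W → {x | x ∈ V ∧ g x = 0} ⊆ W → ∀ᶠ i in l, {x | x ∈ V ∧ G i x = 0} ⊆ W)
    {F : ι → Plane → ℝ} {f : Plane → ℝ} {M : ℝ}
    (hF : ∀ᶠ i in l, ContinuousOn (F i) V) (hFM : ∀ᶠ i in l, ∀ x ∈ V, |F i x| ≤ M)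
    (hf : ContinuousOn f V) (hfM : ∀ x ∈ V, |f x| ≤ M)
    (hFf : ∀ x ∈ V, Tendsto (fun q : ι × Plane => F q.1 q.2) (l ×ˢ 𝓝 x) (𝓝 (f x))) :
    IntegrableOn f {x | x ∈ V ∧ g x = 0} μH[1] ∧
    (∀ᶠ i in l, IntegrableOn (F i) {x | x ∈ V ∧ G i x = 0} μH[1]) ∧
    Tendsto (fun i => ∫ x in {x | x ∈ V ∧ G i x = 0}, F i x ∂μH[1]) l
      (𝓝 (∫ x in {x | x ∈ V ∧ g x = 0}, f x ∂μH[1])) := by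
  have key := fun η (hη : 0 < η) (hη' : η ≤ 1 / 4) => eventually_abs_integral_sub_le hV hg hG hΓ
    hreg hloc hF hFM hf hfM hFf hη hη'
  obtain ⟨h1, h2, -⟩ := key (1 / 4) (by norm_num) le_rfl
  refine ⟨h1, h2, Metric.tendsto_nhds.2 fun ε hε => ?_⟩
  set A := ∫ x in {x | x ∈ V ∧ g x = 0}, |f x| ∂μH[1]
  have hA : 0 ≤ A := integral_nonneg fun _ => abs_nonneg _
  -- This makes `8 * η * A ≤ ε / 4`, to be added to `δ = ε / 2`; `A + 1` guards against `A = 0`.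
  have hη : 0 < min (1 / 4) (ε / (32 * (A + 1))) := lt_min (by norm_num) (by positivity)
  obtain ⟨-, -, h3⟩ := key _ hη (min_le_left _ _)
  filter_upwards [h3 (ε / 2) (by positivity)] with i hi
  rw [Real.dist_eq]
  refine hi.trans_lt ?_
  have h4 : min (1 / 4) (ε / (32 * (A + 1))) * A ≤ ε / 32 := by
    calc _ ≤ ε / (32 * (A + 1)) * A := by gcongr; exact min_le_right _ _
      _ ≤ ε / (32 * (A + 1)) * (A + 1) := by gcongr; linarith
      _ = ε / 32 := by field_simp
  linarith

end LevelSets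

/-! ### Shape functions and the main theorem -/

theorem norm_gradient_eq (f : Plane → ℝ) (x : Plane) : ‖∇ f x‖ = ‖fderiv ℝ f x‖ := by
  simp [gradient]

/-- Needed because the integrands are evaluated at graph points that move with the index. -/
theorem TendstoUniformlyOn.tendsto_prod_nhds {ι α β : Type*} [TopologicalSpace α]
    [PseudoMetricSpace β] {F : ι → α → β} {f : α → β} {l : Filter ι} {V : Set α} {x : α}
    (h : TendstoUniformlyOn F f l V) (hV : V ∈ 𝓝 x) (hf : ContinuousAt f x) :
    Tendsto (fun q : ι × α => F q.1 q.2) (l ×ˢ 𝓝 x) (𝓝 (f x)) := by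
  refine Metric.tendsto_nhds.2 fun ε hε => ?_
  filter_upwards [(Metric.tendstoUniformlyOn_iff.1 h (ε / 2) (half_pos hε)).prod_mk
    (Filter.Eventually.and hV (Metric.tendsto_nhds.1 hf (ε / 2) (half_pos hε)))] with q hq
  have h1 := hq.1 q.2 hq.2.1
  have h2 := hq.2.2
  rw [dist_comm] at h1
  linarith [dist_triangle (F q.1 q.2) (f q.2) (f x)]

theorem IsShapeFunction.fderiv_ne_zero {D E : Set Plane} {g : Plane → ℝ}
    (hg : IsShapeFunction D E g) {x : Plane} (hx : x ∈ D) (hx0 : g x = 0) : fderiv ℝ g x ≠ 0 := by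
  have := hg.regular x hx
  rw [hx0, abs_zero, add_zero, norm_gradient_eq] at this
  exact norm_pos_iff.1 this

/-- Points of `D` with `g < 0` are interior, and `g > 0` on `frontier D`. Conversely, a zero outside
the closure would be a local minimum and a zero inside the domain a local maximum, both excluded by
the nonzero derivative. -/
theorem IsShapeFunction.frontier_shapeDomain {D E : Set Plane} {g : Plane → ℝ} (hD : IsOpen D)
    (hg : IsShapeFunction D E g) :
    frontier (shapeDomain D g) = {x | x ∈ D ∧ g x = 0} := by
  have hcD : ContinuousOn g D := hg.isC2.continuousOn.mono subset_closure
  have hneg : ∀ x ∈ D, g x < 0 → x ∈ shapeDomain D g := by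
    intro x hx hgx
    refine mem_interior.2 ⟨D ∩ g ⁻¹' Iio 0, fun y hy => ⟨hy.1, le_of_lt hy.2⟩,
      hcD.isOpen_inter_preimage hD isOpen_Iio, hx, hgx⟩
  have hopen : IsOpen (shapeDomain D g) := isOpen_interior
  rw [hopen.frontier_eq]
  ext x
  constructor
  · rintro ⟨hx, hx'⟩
    have hcl : IsClosed (closure D ∩ g ⁻¹' Iic 0) :=
      hg.isC2.continuousOn.preimage_isClosed_of_isClosed isClosed_closure isClosed_Iic
    have hsub : shapeDomain D g ⊆ closure D ∩ g ⁻¹' Iic 0 := fun y hy =>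
      ⟨subset_closure (interior_subset hy).1, (interior_subset hy).2⟩
    obtain ⟨h1, h2⟩ := closure_minimal hsub hcl hx
    have h2' : g x ≤ 0 := h2
    have hxD : x ∈ D := by
      by_contra hxD
      have : x ∈ frontier D := by
        rw [hD.frontier_eq]; exact ⟨h1, hxD⟩
      linarith [hg.pos_frontier x this]
    refine ⟨hxD, ?_⟩
    by_contra h0
    exact hx' (hneg x hxD (lt_of_le_of_ne h2' h0))
  · rintro ⟨hxD, hx0⟩
    have hne := hg.fderiv_ne_zero hxD hx0
    constructor
    · by_contra hcl
      refine hne (IsLocalMin.fderiv_eq_zero ?_)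
      filter_upwards [hD.mem_nhds hxD, isClosed_closure.isOpen_compl.mem_nhds hcl] with y hy hy'
      rw [hx0]
      by_contra! hlt
      exact hy' (subset_closure (hneg y hy hlt))
    · intro hin
      refine hne (IsLocalMax.fderiv_eq_zero ?_)
      filter_upwards [hopen.mem_nhds hin] with y hy
      rw [hx0]
      exact (interior_subset hy).2

theorem corollary3p10
    (D E : Set Plane)
    -- the holdall domain is a bounded domain
    (hD_open : IsOpen D) (hD_conn : IsConnected D) (hD_bdd : Bornology.IsBounded D)
    -- the observation set is a subdomain with null boundary, at positive distance from `∂D`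
    (hE_open : IsOpen E) (hE_conn : IsConnected E) (hED : closure E ⊆ D)
    (hE_null : volume (frontier E) = 0)
    -- the shape function, negative on the closure of the observation set
    (gsh : Plane → ℝ) (hgsh : IsShapeFunction D E gsh) (hneg : ∀ x ∈ closure E, gsh x < 0)
    -- a family in `C²(closure D ∖ E)` that converges there to the shape function as `ε ↘ 0`
    (g : ℝ → Plane → ℝ)
    (hg : ∀ ε > 0, IsC2UpTo (D \ closure E) (closure D \ E) (g ε))
    (hg_lim : TendstoC2 (D \ closure E) (closure D \ E) g gsh)
    -- continuous functions that converge uniformly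
    (h : ℝ → Plane → ℝ) (hlim : Plane → ℝ)
    (hh : ∀ ε > 0, ContinuousOn (h ε) (closure D \ E))
    (hh_lim : TendstoUniformlyOn h hlim (𝓝[>] 0) (closure D \ E)) :
    -- the limit integral is well defined
    ((∀ x ∈ frontier (shapeDomain D gsh), ∇ gsh x ≠ 0) ∧
      IntegrableOn (fun x => hlim x / ‖∇ gsh x‖) (frontier (shapeDomain D gsh)) μH[1]) ∧
    -- convergence of the curvilinear integrals
    (∀ z ∈ Icc (0 : ℝ) 1,
      Tendsto (fun ε => ∫ x in levelCurve D E (g ε) (ε * z), h ε x / ‖∇ (g ε) x‖ ∂μH[1])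
        (𝓝[>] 0)
        (𝓝 (∫ x in frontier (shapeDomain D gsh), hlim x / ‖∇ gsh x‖ ∂μH[1]))) ∧
    -- for small `ε` the integrals are well defined and bounded uniformly in `ε` and `z`
    (∃ ε₀ > 0, ∃ c > 0, ∀ ε ∈ Ioc (0 : ℝ) ε₀, ∀ z ∈ Icc (0 : ℝ) 1,
      (∀ x ∈ levelCurve D E (g ε) (ε * z), ∇ (g ε) x ≠ 0) ∧
      IntegrableOn (fun x => h ε x / ‖∇ (g ε) x‖) (levelCurve D E (g ε) (ε * z)) μH[1] ∧
      |∫ x in levelCurve D E (g ε) (ε * z), h ε x / ‖∇ (g ε) x‖ ∂μH[1]| ≤ c) := by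
  simp only [norm_gradient_eq]
  have hfr := hgsh.frontier_shapeDomain hD_open
  have hgrad : ∀ (f : Plane → ℝ) x, fderiv ℝ f x ≠ 0 → ∇ f x ≠ 0 := fun f x hx => by
    rwa [← norm_ne_zero_iff, norm_gradient_eq, norm_ne_zero_iff]
  have hU : IsOpen (D \ closure E) := hD_open.sdiff isClosed_closure
  have hUS : D \ closure E ⊆ closure D \ E :=
    sdiff_le_sdiff subset_closure subset_closure
  have hS : IsCompact (closure D \ E) := hD_bdd.isCompact_closure.diff hE_open
  have hΓU : {x | x ∈ D ∧ gsh x = 0} ⊆ D \ closure E := fun x hx =>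
    ⟨hx.1, fun hxE => (hneg x hxE).ne hx.2⟩
  have hzero : ∀ x ∈ closure D, gsh x = 0 → x ∈ D := by
    intro x hx hx0
    by_contra hxD
    have : x ∈ frontier D := by
      rw [hD_open.frontier_eq]; exact ⟨hx, hxD⟩
    exact (hgsh.pos_frontier x this).ne' hx0
  have hΓ : IsCompact {x | x ∈ D ∧ gsh x = 0} := by
    have hc : IsClosed (closure D ∩ gsh ⁻¹' {0}) :=
      hgsh.isC2.continuousOn.preimage_isClosed_of_isClosed isClosed_closure isClosed_singleton
    have he : {x | x ∈ D ∧ gsh x = 0} = closure D ∩ gsh ⁻¹' {0} := by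
      ext x
      exact ⟨fun hx => ⟨subset_closure hx.1, hx.2⟩, fun hx => ⟨hzero x hx.1 hx.2, hx.2⟩⟩
    rw [he]
    exact hD_bdd.isCompact_closure.of_isClosed_subset hc inter_subset_left
  have hC1 : ContDiffOn ℝ 1 gsh (D \ closure E) :=
    (hgsh.isC2.contDiffOn.mono sdiff_subset).of_le one_le_two
  have hfc : ContinuousOn (fderiv ℝ gsh) (D \ closure E) :=
    hC1.continuousOn_fderiv_of_isOpen hU le_rfl
  have hgc : ContinuousOn gsh (closure D \ E) := hgsh.isC2.continuousOn.mono sdiff_subset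
  -- a neighbourhood of the curve on which the gradient is bounded below
  obtain ⟨K, hK, hΓK, hKU⟩ := exists_compact_between hΓ
    (hfc.isOpen_inter_preimage hU (isOpen_compl_singleton (x := 0)))
    fun x hx => ⟨hΓU hx, hgsh.fderiv_ne_zero hx.1 hx.2⟩
  set V := interior K with hVdef
  have hV : IsOpen V := isOpen_interior
  have hVK : V ⊆ K := interior_subset
  have hVU : V ⊆ D \ closure E := fun x hx => (hKU (hVK hx)).1
  have hVS : V ⊆ closure D \ E := hVU.trans hUS
  obtain ⟨m, hm, hmK⟩ := hK.exists_forall_le' (f := fun x => ‖fderiv ℝ gsh x‖) (a := 0)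
    (hfc.norm.mono fun x hx => (hKU hx).1) fun x hx => norm_pos_iff.2 (hKU hx).2
  have hΓV : {x | x ∈ D ∧ gsh x = 0} = {x | x ∈ V ∧ gsh x = 0} := by
    ext x
    exact ⟨fun hx => ⟨hΓK hx, hx.2⟩, fun hx => ⟨(hVU hx.1).1, hx.2⟩⟩
  rw [hfr]
  have hpos : ∀ᶠ ε in 𝓝[>] (0 : ℝ), 0 < ε := self_mem_nhdsWithin
  have hlc : ContinuousOn hlim (closure D \ E) :=
    hh_lim.continuousOn (hpos.mono fun ε hε => hh ε hε).frequently
  obtain ⟨M, hM⟩ := hS.exists_bound_of_continuousOn hlc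
  -- the family indexed by `(ε, z)`
  set l : Filter (ℝ × ℝ) := 𝓝[>] 0 ×ˢ 𝓟 (Icc 0 1) with hl
  have hfst : Tendsto Prod.fst l (𝓝[>] (0 : ℝ)) := tendsto_fst
  have hsnd : ∀ᶠ q in l, q.2 ∈ Icc (0 : ℝ) 1 :=
    (tendsto_snd : Tendsto Prod.snd l (𝓟 (Icc (0 : ℝ) 1))).eventually (mem_principal_self _)
  set G : ℝ × ℝ → Plane → ℝ := fun q x => g q.1 x - q.1 * q.2 with hGdef
  have hfG : ∀ q, fderiv ℝ (G q) = fderiv ℝ (g q.1) := fun q => by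
    ext1 x
    exact fderiv_sub_const _
  have hGS : TendstoUniformlyOn G gsh l (closure D \ E) := by
    refine Metric.tendstoUniformlyOn_iff.2 fun ε hε => ?_
    filter_upwards [hfst.eventually (Metric.tendstoUniformlyOn_iff.1 hg_lim.zero (ε / 2)
      (half_pos hε)), hfst.eventually hpos, hfst.eventually
      (nhdsWithin_le_nhds (Iio_mem_nhds (half_pos hε))), hsnd] with q h1 h2 h3 h4 x hx
    have k1 := h1 x hx
    have h3' : q.1 < ε / 2 := h3
    have k2 : 0 ≤ q.1 * q.2 := mul_nonneg h2.le h4.1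
    have k3 : q.1 * q.2 ≤ q.1 := mul_le_of_le_one_right h2.le h4.2
    rw [Real.dist_eq, abs_lt] at k1 ⊢
    simp only [hGdef]
    constructor <;> linarith
  have hG1 : TendstoUniformlyOn (fun q => fderiv ℝ (G q)) (fderiv ℝ gsh) l V := by
    simp only [hfG]
    intro u hu
    exact hfst.eventually (hg_lim.one.mono hVU u hu)
  have hGc1 : ∀ᶠ q in l, ContDiffOn ℝ 1 (g q.1) (D \ closure E) :=
    (hfst.eventually hpos).mono fun q hq => (hg _ hq).contDiffOn.of_le one_le_two
  have hG : TendstoC1On l G gsh V := by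
    refine ⟨hGc1.mono fun q hq => ?_, hGS.mono hVS, hG1⟩
    exact ((hq.differentiableOn one_ne_zero).mono hVU).sub_const _
  have hlocU : ∀ W, IsOpen W → {x | x ∈ D ∧ gsh x = 0} ⊆ W →
      ∀ᶠ q in l, {x | x ∈ D \ closure E ∧ G q x = 0} ⊆ W := by
    -- Off `W`, `|gsh|` has a positive lower bound by compactness of `(closure D \ E) \ W`; hence
    -- level curves cannot drift to the boundary of `D` or `E`.
    intro W hW hΓW
    obtain ⟨δ, hδ, hδW⟩ := (hS.diff hW).exists_forall_le' (f := fun x => |gsh x|) (a := 0)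
      (hgc.abs.mono sdiff_subset) fun x hx => abs_pos.2 fun h0 =>
        hx.2 (hΓW ⟨hzero x hx.1.1 h0, h0⟩)
    filter_upwards [Metric.tendstoUniformlyOn_iff.1 hGS δ hδ] with q hq x hx
    by_contra hxW
    have h1 := hq x (hUS hx.1)
    rw [hx.2, Real.dist_eq, sub_zero] at h1
    exact (hδW x ⟨hUS hx.1, hxW⟩).not_gt h1
  have hlevel : ∀ᶠ q in l,
      levelCurve D E (g q.1) (q.1 * q.2) = {x | x ∈ V ∧ G q x = 0} := by
    filter_upwards [hlocU V hV (hΓV.trans_subset fun x hx => hx.1)] with q hq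
    ext x
    constructor
    · rintro ⟨hx, hx0⟩
      have h0 : G q x = 0 := sub_eq_zero.2 hx0
      exact ⟨hq ⟨hx, h0⟩, h0⟩
    · rintro ⟨hx, hx0⟩
      exact ⟨hVU hx, sub_eq_zero.1 hx0⟩
  have hlow : ∀ᶠ q in l, ∀ x ∈ V, m / 2 ≤ ‖fderiv ℝ (g q.1) x‖ := by
    filter_upwards [Metric.tendstoUniformlyOn_iff.1 hG1 (m / 2) (half_pos hm)] with q hq x hx
    have h1 := hq x hx
    rw [hfG, dist_eq_norm] at h1
    have h2 := hmK x (hVK hx)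
    have h3 := norm_sub_norm_le (fderiv ℝ gsh x) (fderiv ℝ (g q.1) x)
    linarith
  have hhl : TendstoUniformlyOn (fun q : ℝ × ℝ => h q.1) hlim l V := fun u hu =>
    hfst.eventually (hh_lim.mono hVS u hu)
  have hdiv : ∀ a b : ℝ, |a| ≤ M + 1 → m / 2 ≤ b → |a / b| ≤ (M + 1) / (m / 2) := by
    intro a b ha hb
    have hb' : 0 < b := (half_pos hm).trans_le hb
    rw [abs_div, abs_of_pos hb']
    exact div_le_div₀ ((abs_nonneg a).trans ha) ha (half_pos hm) hb
  have hV0 : ∀ x ∈ V, ‖fderiv ℝ gsh x‖ ≠ 0 := fun x hx => (hm.trans_le (hmK x (hVK hx))).ne'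
  obtain ⟨hint, hintG, hT⟩ := tendsto_integral_zeroSet (l := l) (G := G) (g := gsh) (V := V)
    (F := fun q x => h q.1 x / ‖fderiv ℝ (g q.1) x‖)
    (f := fun x => hlim x / ‖fderiv ℝ gsh x‖) (M := (M + 1) / (m / 2)) hV (hC1.mono hVU) hG
    (hΓV ▸ hΓ) (fun x hx hx0 => hgsh.fderiv_ne_zero (hVU hx).1 hx0)
    (fun W hW hΓW => (hlocU W hW (hΓV ▸ hΓW)).mono fun q hq x hx => hq ⟨hVU hx.1, hx.2⟩)
    (by
      filter_upwards [hfst.eventually hpos, hGc1, hlow] with q h1 h2 h3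
      exact ((hh _ h1).mono hVS).div
        ((h2.continuousOn_fderiv_of_isOpen hU le_rfl).mono hVU).norm
        fun x hx => ((half_pos hm).trans_le (h3 x hx)).ne')
    (by
      filter_upwards [hlow, Metric.tendstoUniformlyOn_iff.1 hhl 1 one_pos] with q h1 h2 x hx
      refine hdiv _ _ ?_ (h1 x hx)
      have k1 := h2 x hx
      have k2 := hM x (hVS hx)
      rw [Real.dist_eq, abs_sub_comm] at k1
      rw [Real.norm_eq_abs] at k2
      linarith [abs_sub_abs_le_abs_sub (h q.1 x) (hlim x)])
    ((hlc.mono hVS).div (hfc.mono hVU).norm hV0)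
    (fun x hx => hdiv _ _ ((hM x (hVS hx)).trans (by linarith))
      ((half_le_self hm.le).trans (hmK x (hVK hx))))
    (fun x hx => by
      have hVx := hV.mem_nhds hx
      have t1 := hhl.tendsto_prod_nhds hVx ((hlc.mono hVS).continuousAt hVx)
      have t2 := hG1.tendsto_prod_nhds hVx ((hfc.mono hVU).continuousAt hVx)
      simp only [hfG] at t2
      exact t1.div t2.norm (hV0 x hx))
  rw [← hΓV] at hint hT
  have hT' : Tendsto (fun q : ℝ × ℝ => ∫ x in levelCurve D E (g q.1) (q.1 * q.2),
      h q.1 x / ‖fderiv ℝ (g q.1) x‖ ∂μH[1]) l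
      (𝓝 (∫ x in {x | x ∈ D ∧ gsh x = 0}, hlim x / ‖fderiv ℝ gsh x‖ ∂μH[1])) := by
    refine hT.congr' (hlevel.mono fun q hq => ?_)
    simp only [hq]
  refine ⟨⟨fun x hx => hgrad _ x (hgsh.fderiv_ne_zero hx.1 hx.2), hint⟩, fun z hz => ?_, ?_⟩
  · have hz' : Tendsto (fun ε : ℝ => (ε, z)) (𝓝[>] 0) l :=
      tendsto_id.prodMk (tendsto_principal.2 (Eventually.of_forall fun _ => hz))
    exact hT'.comp hz'
  · set I := ∫ x in {x | x ∈ D ∧ gsh x = 0}, hlim x / ‖fderiv ℝ gsh x‖ ∂μH[1]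
    have hev : ∀ᶠ q in l, (∀ x ∈ levelCurve D E (g q.1) (q.1 * q.2), ∇ (g q.1) x ≠ 0) ∧
        IntegrableOn (fun x => h q.1 x / ‖fderiv ℝ (g q.1) x‖)
          (levelCurve D E (g q.1) (q.1 * q.2)) μH[1] ∧
        |∫ x in levelCurve D E (g q.1) (q.1 * q.2),
          h q.1 x / ‖fderiv ℝ (g q.1) x‖ ∂μH[1]| ≤ |I| + 1 := by
      filter_upwards [hlevel, hlow, hintG,
        hT'.abs.eventually_le_const (lt_add_one |I|)] with q h1 h2 h3 h4
      refine ⟨fun x hx => hgrad _ x ?_, by rwa [h1], h4⟩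
      rw [h1] at hx
      exact norm_pos_iff.1 ((half_pos hm).trans_le (h2 x hx.1))
    -- Eventually along the product with a principal filter means: for all small `ε`, simultaneously
    -- for every `z`.
    rw [hl, eventually_prod_principal_iff] at hev
    obtain ⟨ε₀, hε₀, hsub⟩ := mem_nhdsGT_iff_exists_Ioc_subset.1 hev
    exact ⟨ε₀, hε₀, |I| + 1, by positivity, fun ε hε z hz => hsub hε z hz⟩
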